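/- **Setting.** Let $x_1,\dots,x_k\in\mathbb R^d$ be the context vectors of the arms, let $\tilde x$ be one of them (the target), let $\theta^*\in\mathbb R^d$ with $\|\theta^*\|_2\le 1$, and let $R\ge 0$. In round $t$ a bandit algorithm pulls an arm $a_t$ and the environment generates the reward $r_t=x_{a_t}^{\mathsf T}\theta^*+\eta_t$, where the noise variables $\eta_t$ are independent and $R$-sub-Gaussian ($\mathbb E e^{s\eta_t}\le e^{s^2R^2/2}$ for all $s\in\mathbb R$). An adversary sees $a_t$ and $r_t$ and replaces $r_t$ by $\tilde r_t=r_t+\Delta_t$; the algorithm sees only $\tilde r_t$. The choice of $a_t$ is an arbitrary measurable function of a private random seed of the algorithm and of $(a_s,\tilde r_s)_{s<t}$; the choice of $\Delta_t$ is an arbitrary measurable function of a private random seed of the adversary and of $(a_s,r_s)_{s\le t}$. The seeds are independent of each other and of the noise. Neither the algorithm nor the attack is told a time horizon. The cost of the attack is $C(T)=\sum_{t\le T}|\tilde r_t-r_t|$. For $\delta\in(0,1)$, an algorithm is *no-regret with confidence $1-\delta$* (for the given arms) if for every $\theta$ with $\|\theta\|_2\le1$ and every law of independent $R$-sub-Gaussian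 noise its unattacked regret $R_T(\theta)=\sum_{t\le T}\bigl(\max_a x_a^{\mathsf T}\theta-x_{a_t}^{\mathsf T}\theta\bigr)$ satisfies $R_T(\theta)=o(T)$ as $T\to\infty$ with probability at least $1-\delta$. The environment is *attackable* with respect to $\tilde x$ if for every $\delta\in(0,1)$ and every algorithm that is no-regret with confidence $1-\delta$ there is an attack such that, with probability at least $1-\delta$, both $C(T)=o(T)$ and $\tilde x$ is pulled $T-o(T)$ times in the first $T$ rounds, as $T\to\infty$. Let $\theta^*_\parallel$ be the orthogonal projection of $\theta^*$ onto the span of $\tilde x$, and let $\epsilon^*\in(-\infty,\infty]$ be the optimal value (supremum) of the convex program $$\max_{\epsilon\in\mathbb R,\ \tilde\theta_\perp\in\mathbb R^d}\ \epsilon\quad\text{s.t.}\quad \tilde x^{\mathsf T}\theta^*_\parallel\ \ge\ \epsilon+x_a^{\mathsf T}(\theta^*_\parallel+\tilde\theta_\perp)\ \ \forall x_a\ne\tilde x,\qquad \tilde x^{\mathsf T}\tilde\theta_\perp=0,\qquad \|\theta^*_\parallel+\tilde\theta_\perp\|_2\le 1 .$$ **Theorem.** For every law of independent $R$-sub-Gaussian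 noise, the environment is attackable with respect to $\tilde x$ if and only if $\epsilon^*>0$. -/

import Mathlib

open MeasureTheory ProbabilityTheory Filter Asymptotics
open scoped NNReal ENNReal

noncomputable section

namespace LinBandit

/-- Arms are indexed by `Fin k`; the context vector of arm `a` is `x a`. -/
abbrev Vec (d : ℕ) : Type := EuclideanSpace ℝ (Fin d)

/-! ### Noise, bandit algorithms and attacks -/

/-- `μ` is the law of a noise sequence `η₀, η₁, …` of independent `R`-sub-Gaussian variables:
`𝔼 exp (s ηₜ) ≤ exp (s² R² / 2)` for all real `s`. -/
structure IsSubGaussianNoise (R : ℝ≥0) (μ : Measure (ℕ → ℝ)) : Prop where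
  isProbabilityMeasure : IsProbabilityMeasure μ
  indep : iIndepFun (fun (t : ℕ) (η : ℕ → ℝ) => η t) μ
  subgaussian : ∀ t : ℕ, HasSubgaussianMGF (fun η : ℕ → ℝ => η t) (R ^ 2) μ

/-- A (possibly randomized) bandit algorithm: in round `t` it chooses an arm from its private random
seed (uniform on `[0,1]`) and from the arms pulled and the rewards it observed in rounds
`0, …, t - 1`. -/
structure Algorithm (k : ℕ) where
  pull : (t : ℕ) → unitInterval → (Fin t → Fin k × ℝ) → Fin k
  measurable_pull : ∀ t, Measurable
    (fun p : unitInterval × (Fin t → Fin k × ℝ) => pull t p.1 p.2)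

/-- A (possibly randomized) adaptive attack: in round `t` the adversary chooses the amount that is
added to the reward, from its own random seed (uniform on `[0,1]`) and from the arms pulled and the
true rewards generated in rounds `0, …, t`. -/
structure Attack (k : ℕ) where
  corrupt : (t : ℕ) → unitInterval → (Fin (t + 1) → Fin k × ℝ) → ℝ
  measurable_corrupt : ∀ t, Measurable
    (fun p : unitInterval × (Fin (t + 1) → Fin k × ℝ) => corrupt t p.1 p.2)

/-- The attack that never changes a reward. -/
def Attack.none (k : ℕ) : Attack k where
  corrupt := fun _ _ _ => 0
  measurable_corrupt := fun _ => measurable_const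

/-! ### The interaction -/

/-- What happens in one round. -/
structure Round (k : ℕ) where
  /-- the arm pulled by the algorithm -/
  arm : Fin k
  /-- the reward generated by the environment -/
  reward : ℝ
  /-- the reward shown to the algorithm -/
  observed : ℝ

/-- Sample points: the seed of the algorithm, the seed of the adversary, the noise sequence. -/
abbrev Sample : Type := unitInterval × unitInterval × (ℕ → ℝ)

/-- The seeds are independent of each other and of the noise, and the noise has law `μ`. -/
def sampleMeasure (μ : Measure (ℕ → ℝ)) : Measure Sample :=
  (volume : Measure unitInterval).prod ((volume : Measure unitInterval).prod μ)

variable {d k : ℕ}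

/-- The first `t` rounds when `alg` plays in the linear bandit with arms `x` and parameter `θ`
while `att` corrupts the rewards. -/
def history (x : Fin k → Vec d) (θ : Vec d) (alg : Algorithm k) (att : Attack k) (ω : Sample) :
    (t : ℕ) → Fin t → Round k
  | 0 => Fin.elim0
  | t + 1 =>
    let h := history x θ alg att ω t
    let a : Fin k := alg.pull t ω.1 (fun i => ((h i).arm, (h i).observed))
    let r : ℝ := inner ℝ (x a) θ + ω.2.2 t
    let Δ : ℝ := att.corrupt t ω.2.1
      (Fin.snoc (α := fun _ => Fin k × ℝ) (fun i => ((h i).arm, (h i).reward)) (a, r))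
    Fin.snoc (α := fun _ => Round k) h ⟨a, r, r + Δ⟩

/-- Round `t` of the interaction. -/
def roundAt (x : Fin k → Vec d) (θ : Vec d) (alg : Algorithm k) (att : Attack k) (ω : Sample)
    (t : ℕ) : Round k :=
  history x θ alg att ω (t + 1) (Fin.last t)

/-- The (pseudo-)regret of `alg` after `T` rounds in the unattacked bandit with parameter `θ`. -/
def regret (x : Fin k → Vec d) (θ : Vec d) (alg : Algorithm k) (ω : Sample) (T : ℕ) : ℝ :=
  ∑ t ∈ Finset.range T,
    ((⨆ a, inner ℝ (x a) θ) - inner ℝ (x (roundAt x θ alg (Attack.none k) ω t).arm) θ)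

/-- The total cost of the attack in the first `T` rounds. -/
def attackCost (x : Fin k → Vec d) (θ : Vec d) (alg : Algorithm k) (att : Attack k) (ω : Sample)
    (T : ℕ) : ℝ :=
  ∑ t ∈ Finset.range T,
    |(roundAt x θ alg att ω t).observed - (roundAt x θ alg att ω t).reward|

/-- How often the context vector `y` is pulled in the first `T` rounds. -/
def pullCount (x : Fin k → Vec d) (θ : Vec d) (alg : Algorithm k) (att : Attack k) (ω : Sample)
    (y : Vec d) (T : ℕ) : ℕ :=
  {t ∈ Finset.range T | x (roundAt x θ alg att ω t).arm = y}.card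

/-! ### Attackability -/

/-- `alg` is a no-regret algorithm at confidence level `1 - δ` for the arms `x`: whatever the
parameter in the unit ball and the `R`-sub-Gaussian noise, its regret is `o(T)` with probability at
least `1 - δ`. -/
def NoRegret (R : ℝ≥0) (x : Fin k → Vec d) (δ : ℝ) (alg : Algorithm k) : Prop :=
  ∀ θ : Vec d, ‖θ‖ ≤ 1 → ∀ μ : Measure (ℕ → ℝ), IsSubGaussianNoise R μ →
    ENNReal.ofReal (1 - δ) ≤ sampleMeasure μ
      {ω | (fun T : ℕ => regret x θ alg ω T) =o[atTop] (fun T : ℕ => (T : ℝ))}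

/-- The event that `att` costs `o(T)` and makes `alg` pull the target `T - o(T)` times. -/
def attackSuccess (x : Fin k → Vec d) (target : Fin k) (θ : Vec d) (alg : Algorithm k)
    (att : Attack k) : Set Sample :=
  {ω | (fun T : ℕ => attackCost x θ alg att ω T) =o[atTop] (fun T : ℕ => (T : ℝ)) ∧
    (fun T : ℕ => (T : ℝ) - pullCount x θ alg att ω (x target) T)
      =o[atTop] (fun T : ℕ => (T : ℝ))}

/-- The bandit with arms `x`, parameter `θ` and noise law `μ` is attackable with respect to the
target: every no-regret algorithm can be attacked successfully, with the same confidence. -/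
def Attackable (R : ℝ≥0) (x : Fin k → Vec d) (target : Fin k) (θ : Vec d)
    (μ : Measure (ℕ → ℝ)) : Prop :=
  ∀ δ : ℝ, 0 < δ → δ < 1 → ∀ alg : Algorithm k, NoRegret R x δ alg →
    ∃ att : Attack k,
      ENNReal.ofReal (1 - δ) ≤ sampleMeasure μ (attackSuccess x target θ alg att)

/-! ### The convex quadratic program -/

/-- The component of `θ` along `y` (it is `0` if `y = 0`). -/
def parallelPart (y θ : Vec d) : Vec d := (inner ℝ y θ / ‖y‖ ^ 2) • y

/-- The feasible pairs `(ε, v)` of the program; `v` is the component orthogonal to the target. -/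
def feasibleSet (x : Fin k → Vec d) (target : Fin k) (θ : Vec d) : Set (ℝ × Vec d) :=
  {p | (∀ a, x a ≠ x target →
        p.1 + inner ℝ (x a) (parallelPart (x target) θ + p.2)
          ≤ inner ℝ (x target) (parallelPart (x target) θ)) ∧
      inner ℝ (x target) p.2 = 0 ∧
      ‖parallelPart (x target) θ + p.2‖ ≤ 1}

/-- The optimal value of the program: the supremum of `ε` over the feasible pairs, taken in the
extended reals (it is `⊤` if every context vector equals that of the target). -/
def attackabilityIndex (x : Fin k → Vec d) (target : Fin k) (θ : Vec d) : EReal :=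
  ⨆ p ∈ feasibleSet x target θ, (p.1 : EReal)

end LinBandit

end

/-! If the index is positive, some `θ'` in the unit ball agrees with `θ` on the target and makes the
target strictly optimal with a gap `ε`. Adding `⟨x a, θ' - θ⟩` to each reward makes the attacked
bandit coincide, sample by sample, with the unattacked bandit of parameter `θ'`. No regret there
bounds the non-target pulls by regret divided by `ε`, hence by `o(T)`; only those pulls cost
anything (`attackSuccess_of_regret_isLittleO`).

If the index is at most `0`, put `m = ⟨x target, θ⟩`. Every `θ'` in the unit ball with `⟨x target,
θ'⟩ = m` has a non-target arm at least as good as the target (`exists_ne_target_inner_le`), so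
refusing the target is harmless whenever its mean is `m`. `gatedAlgorithm` follows the leader, with
sparse forced exploration, but refuses the target for a whole dyadic block when the target has been
pulled almost always and the average observed reward is close to `m`. A successful attack must
create this situation at all large times, and then the refusals destroy it
(`notMem_attackSuccess_gatedAlgorithm`). Without an attack, refusals recur forever only if the
target's mean really is `m`, where they cost nothing (`inner_target_eq_of_frequently_gate`,
`eventually_optimal`). Both arguments are pathwise; probability enters only through the strong law.
-/

noncomputable section

namespace LinBandit

open Topology

/-! ### A strong law of large numbers for sub-Gaussian variables -/

/-- The Chernoff bound `exp (-n ε² / (2c))` is summable in `n`, so Borel–Cantelli applies. -/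
lemma ae_eventually_sum_lt_of_subgaussian {Ω : Type*} [MeasurableSpace Ω] {μ : Measure Ω}
    [IsProbabilityMeasure μ] {X : ℕ → Ω → ℝ} {c : ℝ≥0} (hc : 0 < c) (hi : iIndepFun X μ)
    (hX : ∀ i, HasSubgaussianMGF (X i) c μ) {ε : ℝ} (hε : 0 < ε) :
    ∀ᵐ ω ∂μ, ∀ᶠ n : ℕ in atTop, ∑ i ∈ Finset.range n, X i ω < ε * n := by
  have hc' : (0 : ℝ) < c := by exact_mod_cast hc
  have hb : ∀ n : ℕ, μ {ω | ε * n ≤ ∑ i ∈ Finset.range n, X i ω} ≤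
      ENNReal.ofReal (Real.exp (n * (-(ε ^ 2 / (2 * c))))) := by
    intro n
    have h := HasSubgaussianMGF.measure_sum_range_ge_le_of_iIndepFun hi (c := c) (n := n)
      (fun i _ => hX i) (ε := ε * n) (by positivity)
    rw [← ENNReal.ofReal_toReal (measure_ne_top μ {ω | ε * n ≤ ∑ i ∈ Finset.range n, X i ω})]
    refine ENNReal.ofReal_le_ofReal (h.trans (le_of_eq ?_))
    rcases Nat.eq_zero_or_pos n with rfl | hn
    · simp
    · congr 1
      field_simp
  have hs : Summable fun n : ℕ => Real.exp (n * (-(ε ^ 2 / (2 * c)))) :=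
    Real.summable_exp_nat_mul_iff.mpr (neg_neg_of_pos (by positivity))
  have hfin : ∑' n, μ {ω | ε * n ≤ ∑ i ∈ Finset.range n, X i ω} ≠ ∞ :=
    ne_top_of_le_ne_top hs.tsum_ofReal_ne_top (ENNReal.tsum_le_tsum hb)
  filter_upwards [ae_eventually_notMem hfin] with ω hω
  filter_upwards [hω] with n hn
  simpa using hn

lemma ae_tendsto_average_of_subgaussian {Ω : Type*} [MeasurableSpace Ω] {μ : Measure Ω}
    [IsProbabilityMeasure μ] {X : ℕ → Ω → ℝ} {c : ℝ≥0} (hc : 0 < c) (hi : iIndepFun X μ)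
    (hX : ∀ i, HasSubgaussianMGF (X i) c μ) :
    ∀ᵐ ω ∂μ, Tendsto (fun n : ℕ => (∑ i ∈ Finset.range n, X i ω) / n) atTop (𝓝 0) := by
  have h1 : ∀ᵐ ω ∂μ, ∀ m : ℕ, ∀ᶠ n : ℕ in atTop,
      ∑ i ∈ Finset.range n, X i ω < 1 / ((m : ℝ) + 1) * n :=
    ae_all_iff.2 fun m => ae_eventually_sum_lt_of_subgaussian hc hi hX (by positivity)
  have h2 : ∀ᵐ ω ∂μ, ∀ m : ℕ, ∀ᶠ n : ℕ in atTop,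
      ∑ i ∈ Finset.range n, (-X i ω) < 1 / ((m : ℝ) + 1) * n :=
    ae_all_iff.2 fun m => ae_eventually_sum_lt_of_subgaussian (X := fun i ω => -X i ω) hc
      (hi.comp (fun _ y => -y) fun _ => measurable_neg) (fun i => (hX i).neg) (by positivity)
  filter_upwards [h1, h2] with ω h1 h2
  rw [Metric.tendsto_atTop']
  intro ε hε
  obtain ⟨m, hm⟩ := exists_nat_one_div_lt hε
  obtain ⟨N, hN⟩ := eventually_atTop.1 ((h1 m).and (h2 m))
  refine ⟨N, fun n hn => ?_⟩
  obtain ⟨ha, hb⟩ := hN n hn.le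
  have hn0 : (0 : ℝ) < n := by exact_mod_cast (Nat.zero_le N).trans_lt hn
  rw [Real.dist_eq, sub_zero, abs_lt]
  rw [Finset.sum_neg_distrib] at hb
  constructor
  · rw [lt_div_iff₀ hn0]; nlinarith
  · rw [div_lt_iff₀ hn0]; nlinarith

lemma IsSubGaussianNoise.ae_tendsto_average {R : ℝ≥0} {μ : Measure (ℕ → ℝ)}
    (hμ : IsSubGaussianNoise R μ) {s : ℕ → ℕ} (hs : s.Injective) :
    ∀ᵐ η : ℕ → ℝ ∂μ,
      Tendsto (fun n : ℕ => (∑ i ∈ Finset.range n, η (s i)) / (n : ℝ)) atTop (𝓝 0) := by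
  have := hμ.isProbabilityMeasure
  -- The parameter is enlarged from `R ^ 2` to `R ^ 2 + 1` because `R` may be `0` and the Chernoff
  -- exponent divides by it.
  have hsub (i : ℕ) : HasSubgaussianMGF (fun η : ℕ → ℝ => η (s i)) (R ^ 2 + 1) μ := by
    refine ⟨(hμ.subgaussian (s i)).integrable_exp_mul, fun t =>
      ((hμ.subgaussian (s i)).mgf_le t).trans (Real.exp_le_exp.2 ?_)⟩
    push_cast
    nlinarith [sq_nonneg t]
  have hi : iIndepFun (fun (i : ℕ) (η : ℕ → ℝ) => η (s i)) μ :=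
    iIndepFun.precomp (f := fun (t : ℕ) (η : ℕ → ℝ) => η t) hs hμ.indep
  exact ae_tendsto_average_of_subgaussian (c := R ^ 2 + 1) (by positivity) hi hsub

/-! ### The interaction, round by round -/

section Interaction

variable {d k : ℕ} (x : Fin k → Vec d) (θ : Vec d) (alg : Algorithm k) (att : Attack k)
  (ω : Sample)

lemma history_eq_roundAt (t : ℕ) (i : Fin t) :
    history x θ alg att ω t i = roundAt x θ alg att ω i := by
  induction t with
  | zero => exact i.elim0
  | succ t ih =>
    refine Fin.lastCases ?_ (fun j => ?_) i
    · rfl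
    · rw [Fin.val_castSucc, ← ih j]
      simp only [history, Fin.snoc_castSucc]

lemma arm_roundAt (t : ℕ) :
    (roundAt x θ alg att ω t).arm = alg.pull t ω.1 fun i =>
      ((roundAt x θ alg att ω i).arm, (roundAt x θ alg att ω i).observed) := by
  conv_lhs => rw [roundAt]; simp only [history, Fin.snoc_last, history_eq_roundAt]

lemma reward_roundAt (t : ℕ) :
    (roundAt x θ alg att ω t).reward =
      inner ℝ (x (roundAt x θ alg att ω t).arm) θ + ω.2.2 t := by
  conv_lhs => rw [roundAt]; simp only [history, Fin.snoc_last, history_eq_roundAt]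
  rw [arm_roundAt]

lemma observed_roundAt (t : ℕ) :
    (roundAt x θ alg att ω t).observed = (roundAt x θ alg att ω t).reward +
      att.corrupt t ω.2.1 fun i =>
        ((roundAt x θ alg att ω i).arm, (roundAt x θ alg att ω i).reward) := by
  conv_lhs => rw [roundAt]; simp only [history, Fin.snoc_last, history_eq_roundAt]
  rw [reward_roundAt, arm_roundAt]
  congr 2
  funext i
  refine Fin.lastCases ?_ (fun j => ?_) i
  · rw [Fin.snoc_last, Fin.val_last, reward_roundAt, arm_roundAt]
  · rw [Fin.snoc_castSucc, Fin.val_castSucc]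

lemma observed_roundAt_none (t : ℕ) :
    (roundAt x θ alg (Attack.none k) ω t).observed =
      inner ℝ (x (roundAt x θ alg (Attack.none k) ω t).arm) θ + ω.2.2 t := by
  rw [observed_roundAt, reward_roundAt]
  exact add_zero _

/-- The attack that shifts the rewards so that they look generated by another parameter. -/
def Attack.shift (x : Fin k → Vec d) (v : Vec d) : Attack k where
  corrupt := fun t _ h => inner ℝ (x (h (Fin.last t)).1) v
  measurable_corrupt := fun t =>
    (Measurable.of_discrete (f := fun a : Fin k => (inner ℝ (x a) v : ℝ))).comp
      (measurable_fst.comp ((measurable_pi_apply (Fin.last t)).comp measurable_snd))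

lemma observed_roundAt_shift (v : Vec d) (t : ℕ) :
    (roundAt x θ alg (Attack.shift x v) ω t).observed =
      (roundAt x θ alg (Attack.shift x v) ω t).reward +
        inner ℝ (x (roundAt x θ alg (Attack.shift x v) ω t).arm) v := by
  rw [observed_roundAt]
  rfl

/-- A coupling on the same `ω`: as long as the arms agree, the shifted reward `⟨x a, θ⟩ + η + ⟨x a,
v⟩` is exactly the unattacked reward under `θ + v`, so the algorithm has the same past and makes the
same choice. -/
lemma arm_roundAt_shift (v : Vec d) (t : ℕ) :
    (roundAt x θ alg (Attack.shift x v) ω t).arm =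
      (roundAt x (θ + v) alg (Attack.none k) ω t).arm := by
  induction t using Nat.strong_induction_on with
  | _ t ih =>
    rw [arm_roundAt, arm_roundAt]
    congr 1
    funext i
    rw [observed_roundAt_shift, reward_roundAt, observed_roundAt_none, ih i i.2, inner_add_right,
      add_right_comm]

lemma sub_pullCount (y : Vec d) (T : ℕ) :
    (T : ℝ) - pullCount x θ alg att ω y T =
      ∑ t ∈ Finset.range T, if x (roundAt x θ alg att ω t).arm = y then (0 : ℝ) else 1 := by
  rw [pullCount, Finset.card_filter]
  push_cast
  rw [sub_eq_iff_eq_add, ← Finset.sum_add_distrib,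
    Finset.sum_congr rfl (g := fun _ => (1 : ℝ)) (fun t _ => by split_ifs <;> simp)]
  simp

end Interaction

/-! ### Attackability when the index is positive -/

section Positive

variable {d k : ℕ} (x : Fin k → Vec d) (target : Fin k) (θ : Vec d)

lemma inner_parallelPart (y θ : Vec d) : inner ℝ y (parallelPart y θ) = (inner ℝ y θ : ℝ) := by
  rw [parallelPart, inner_smul_right, real_inner_self_eq_norm_sq]
  rcases eq_or_ne y 0 with rfl | hy
  · simp
  · have : ‖y‖ ≠ 0 := norm_ne_zero_iff.2 hy
    field_simp

/-- Each non-target pull contributes at least `ε` to the regret under `θ'`. By `hθ'` the shift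
vanishes on the target, so the cost is at most a constant times the number of non-target pulls. -/
lemma attackSuccess_of_regret_isLittleO {θ' : Vec d} {ε : ℝ} (hε : 0 < ε)
    (hθ' : (inner ℝ (x target) θ' : ℝ) = inner ℝ (x target) θ)
    (hgap : ∀ a, x a ≠ x target → ε + inner ℝ (x a) θ' ≤ (inner ℝ (x target) θ' : ℝ))
    (alg : Algorithm k) {ω : Sample}
    (hω : (fun T : ℕ => regret x θ' alg ω T) =o[atTop] (fun T : ℕ => (T : ℝ))) :
    ω ∈ attackSuccess x target θ alg (Attack.shift x (θ' - θ)) := by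
  have harm (t : ℕ) := arm_roundAt_shift x θ alg ω (θ' - θ) t
  rw [add_sub_cancel] at harm
  have hN : (fun T : ℕ => (T : ℝ) - pullCount x θ alg (Attack.shift x (θ' - θ)) ω (x target) T)
      =o[atTop] (fun T : ℕ => (T : ℝ)) := by
    refine (IsBigO.of_bound ε⁻¹ (Eventually.of_forall fun T => ?_)).trans_isLittleO hω
    rw [sub_pullCount, Real.norm_of_nonneg
      (Finset.sum_nonneg fun t _ => by split_ifs <;> simp), inv_mul_eq_div, le_div_iff₀ hε,
      Finset.sum_mul]
    refine le_trans (Finset.sum_le_sum fun t _ => ?_) (le_abs_self _)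
    have hsup : ∀ a, (inner ℝ (x a) θ' : ℝ) ≤ ⨆ a, inner ℝ (x a) θ' :=
      fun a => le_ciSup (f := fun a => (inner ℝ (x a) θ' : ℝ)) (Set.finite_range _).bddAbove a
    rw [harm]
    split_ifs with h
    · rw [zero_mul]
      exact sub_nonneg.2 (hsup _)
    · have := hgap _ h
      have := hsup target
      linarith
  refine ⟨?_, hN⟩
  obtain ⟨C, hC⟩ := (Set.finite_range fun a => |(inner ℝ (x a) (θ' - θ) : ℝ)|).bddAbove
  refine (IsBigO.of_bound C (Eventually.of_forall fun T => ?_)).trans_isLittleO hN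
  rw [sub_pullCount, attackCost, Real.norm_of_nonneg (Finset.sum_nonneg fun t _ => abs_nonneg _),
    Real.norm_of_nonneg (Finset.sum_nonneg fun t _ => by split_ifs <;> simp), Finset.mul_sum]
  refine Finset.sum_le_sum fun t _ => ?_
  rw [observed_roundAt_shift, add_sub_cancel_left]
  split_ifs with h
  · rw [h, inner_sub_right, hθ']
    simp
  · rw [mul_one]
    exact hC ⟨_, rfl⟩

theorem attackable_of_attackabilityIndex_pos (R : ℝ≥0) (μ : Measure (ℕ → ℝ))
    (hμ : IsSubGaussianNoise R μ) (h : 0 < attackabilityIndex x target θ) :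
    Attackable R x target θ μ := by
  intro δ _ _ alg halg
  obtain ⟨p, hp⟩ := lt_iSup_iff.1 h
  obtain ⟨⟨hgap, horth, hnorm⟩, hp⟩ := lt_iSup_iff.1 hp
  have hin : (inner ℝ (x target) (parallelPart (x target) θ + p.2) : ℝ) =
      inner ℝ (x target) θ := by
    rw [inner_add_right, horth, add_zero, inner_parallelPart]
  refine ⟨Attack.shift x (parallelPart (x target) θ + p.2 - θ),
    (halg _ hnorm μ hμ).trans (measure_mono fun ω hω => ?_)⟩
  refine attackSuccess_of_regret_isLittleO x target θ (EReal.coe_pos.1 hp) hin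
    (fun a ha => ?_) alg hω
  rw [hin]
  exact (hgap a ha).trans_eq (inner_parallelPart _ _)

/-- A parameter that agrees with `θ` on the target does not make the target strictly optimal. -/
lemma exists_ne_target_inner_le (h : attackabilityIndex x target θ ≤ 0) {θ' : Vec d}
    (hnorm : ‖θ'‖ ≤ 1) (hθ' : (inner ℝ (x target) θ' : ℝ) = inner ℝ (x target) θ) :
    ∃ a, x a ≠ x target ∧ (inner ℝ (x target) θ' : ℝ) ≤ inner ℝ (x a) θ' := by
  by_contra! hcon
  -- There are finitely many arms, so strict optimality of the target leaves a uniform positive gap,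
  -- which would make the index positive.
  have hev : ∀ᶠ ε : ℝ in 𝓝[>] 0, ∀ a, x a ≠ x target →
      ε + inner ℝ (x a) θ' ≤ (inner ℝ (x target) θ' : ℝ) := by
    refine eventually_all.2 fun a => ?_
    by_cases ha : x a = x target
    · exact Eventually.of_forall fun _ h => absurd ha h
    · have := hcon a ha
      filter_upwards [Ioo_mem_nhdsGT (sub_pos.2 this)] with ε hε _
      linarith [hε.2]
  obtain ⟨ε, hε, hpos⟩ := (hev.and self_mem_nhdsWithin).exists
  have hmem : (ε, θ' - parallelPart (x target) θ) ∈ feasibleSet x target θ := by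
    refine ⟨fun a ha => ?_, ?_, ?_⟩
    · simp only [add_sub_cancel]
      rw [inner_parallelPart, ← hθ']
      exact hε a ha
    · rw [inner_sub_right, inner_parallelPart, hθ', sub_self]
    · simpa using hnorm
  have h1 : ((ε : ℝ) : EReal) ≤ attackabilityIndex x target θ :=
    le_iSup₂_of_le (f := fun p (_ : p ∈ feasibleSet x target θ) => (p.1 : EReal)) _ hmem le_rfl
  exact absurd (EReal.coe_le_coe_iff.1 (h1.trans h)) (not_le.2 hpos)

end Positive

/-! ### The gated follow-the-leader algorithm -/

section Algorithm

variable {d k : ℕ}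

open Classical in
/-- A maximizer of `v` on `S`; the arm `a₀` if there is none. -/
def argmaxOn (a₀ : Fin k) (S : Set (Fin k)) (v : Fin k → ℝ) : Fin k :=
  if h : ∃ a ∈ S, ∀ b ∈ S, v b ≤ v a then h.choose else a₀

lemma argmaxOn_spec (a₀ : Fin k) {S : Set (Fin k)} (hS : S.Nonempty) (v : Fin k → ℝ) :
    argmaxOn a₀ S v ∈ S ∧ ∀ b ∈ S, v b ≤ v (argmaxOn a₀ S v) := by
  have h : ∃ a ∈ S, ∀ b ∈ S, v b ≤ v a := Set.exists_max_image S v S.toFinite hS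
  rw [argmaxOn, dif_pos h]
  exact h.choose_spec

lemma measurable_argmaxOn (a₀ : Fin k) (S : Set (Fin k)) : Measurable (argmaxOn a₀ S) := by
  classical
  -- The choice depends on `v` only through the comparisons `v b ≤ v a`, which take values in a
  -- finite discrete space.
  let g : (Fin k → Fin k → Prop) → Fin k := fun r =>
    if h : ∃ a ∈ S, ∀ b ∈ S, r b a then h.choose else a₀
  have hg : Measurable g := Measurable.of_discrete
  have hr : Measurable fun (v : Fin k → ℝ) (b a : Fin k) => v b ≤ v a :=
    measurable_pi_lambda _ fun b => measurable_pi_lambda _ fun a =>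
      measurableSet_setOfPred.1 (measurableSet_le (measurable_pi_apply b) (measurable_pi_apply a))
  exact hg.comp hr

/-- The average of the rewards observed in the rounds before `t` that explore the arm `a`. -/
def exploreMean (f : ℕ → Fin k × ℝ) (t : ℕ) (a : Fin k) : ℝ :=
  (∑ i ∈ Finset.range (Nat.sqrt t / k), (f ((k * i + a) ^ 2)).2) / ((Nat.sqrt t / k : ℕ) : ℝ)

/-- The distance of the average observed reward from `m` plus the fraction of rounds in which the
target is not pulled, plus a positive term that tends to `0`. -/
def deviation (x : Fin k → Vec d) (target : Fin k) (m : ℝ) (f : ℕ → Fin k × ℝ) (T : ℕ) : ℝ :=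
  |∑ t ∈ Finset.range T, ((f t).2 - m)| / T
    + (∑ t ∈ Finset.range T, if x (f t).1 = x target then (0 : ℝ) else 1) / T + 1 / ((T : ℝ) + 1)

/-- The deviation falls below some level `1 / (j + 1)` for the first time at `2 ^ i`. -/
def Gate (x : Fin k → Vec d) (target : Fin k) (m : ℝ) (f : ℕ → Fin k × ℝ) (i : ℕ) : Prop :=
  ∃ j : ℕ, deviation x target m f (2 ^ i) < 1 / ((j : ℝ) + 1) ∧
    ∀ i' < i, 1 / ((j : ℝ) + 1) ≤ deviation x target m f (2 ^ i')

open Classical in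
/-- In the rounds `n ^ 2` explore the arms cyclically; in the other rounds play the best arm
according to the exploration rounds, among the non-target arms if the gate is open for the dyadic
block of `t`, and among all arms otherwise. -/
def gatedChoice (x : Fin k → Vec d) (target : Fin k) (m : ℝ) (t : ℕ) (f : ℕ → Fin k × ℝ) : Fin k :=
  if IsSquare t then ⟨Nat.sqrt t % k, Nat.mod_lt _ target.pos⟩
  else if Gate x target m f (Nat.log 2 t) then
    argmaxOn target {a | x a ≠ x target} (exploreMean f t)
  else argmaxOn target Set.univ (exploreMean f t)

/-- Extend a finite sequence by a constant. -/
def extendBy {α : Type*} (c : α) (t : ℕ) (h : Fin t → α) (s : ℕ) : α :=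
  if hs : s < t then h ⟨s, hs⟩ else c

lemma measurable_extendBy {α : Type*} [MeasurableSpace α] (c : α) (t : ℕ) :
    Measurable (extendBy c t) := by
  refine measurable_pi_lambda _ fun s => ?_
  unfold extendBy
  split_ifs with hs
  · exact measurable_pi_apply _
  · exact measurable_const

variable (x : Fin k → Vec d) (target : Fin k) (m : ℝ)

lemma measurable_exploreMean (t : ℕ) :
    Measurable fun f : ℕ → Fin k × ℝ => exploreMean f t := by
  unfold exploreMean
  fun_prop

lemma measurable_deviation (T : ℕ) :
    Measurable fun f : ℕ → Fin k × ℝ => deviation x target m f T := by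
  have h (t : ℕ) : Measurable fun f : ℕ → Fin k × ℝ =>
      if x (f t).1 = x target then (0 : ℝ) else 1 :=
    (Measurable.of_discrete (f := fun a : Fin k => if x a = x target then (0 : ℝ) else 1)).comp
      (measurable_fst.comp (measurable_pi_apply t))
  unfold deviation
  fun_prop

lemma measurableSet_gate (i : ℕ) :
    MeasurableSet {f : ℕ → Fin k × ℝ | Gate x target m f i} := by
  unfold Gate
  simp only [Set.ofPred_exists, Set.ofPred_and, Set.ofPred_forall]
  exact MeasurableSet.iUnion fun j =>
    (measurableSet_lt (measurable_deviation x target m _) measurable_const).inter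
      (MeasurableSet.iInter fun i' => MeasurableSet.iInter fun _ =>
        measurableSet_le measurable_const (measurable_deviation x target m _))

lemma measurable_gatedChoice (t : ℕ) : Measurable (gatedChoice x target m t) := by
  unfold gatedChoice
  split_ifs with h
  · exact measurable_const
  · exact Measurable.ite (measurableSet_gate x target m _)
      ((measurable_argmaxOn _ _).comp (measurable_exploreMean t))
      ((measurable_argmaxOn _ _).comp (measurable_exploreMean t))

lemma exploreMean_congr {f g : ℕ → Fin k × ℝ} {t : ℕ} (h : ∀ s < t, f s = g s) :
    exploreMean f t = exploreMean g t := by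
  funext a
  unfold exploreMean
  congr 1
  refine Finset.sum_congr rfl fun i hi => ?_
  rw [h]
  have h1 : k * (i + 1) ≤ Nat.sqrt t :=
    (Nat.mul_le_mul_left k (Finset.mem_range.1 hi)).trans (Nat.mul_div_le _ _)
  have h2 : k * i + a < Nat.sqrt t := by
    have := a.2
    rw [mul_add, mul_one] at h1
    omega
  exact (Nat.pow_lt_pow_left h2 two_ne_zero).trans_le (Nat.sqrt_le' t)

lemma deviation_congr {f g : ℕ → Fin k × ℝ} {T : ℕ} (h : ∀ s < T, f s = g s) :
    deviation x target m f T = deviation x target m g T := by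
  unfold deviation
  congr 3
  · congr 1
    exact Finset.sum_congr rfl fun t ht => by rw [h t (Finset.mem_range.1 ht)]
  · exact Finset.sum_congr rfl fun t ht => by rw [h t (Finset.mem_range.1 ht)]

lemma gatedChoice_congr {f g : ℕ → Fin k × ℝ} {t : ℕ} (h : ∀ s < t, f s = g s) :
    gatedChoice x target m t f = gatedChoice x target m t g := by
  unfold gatedChoice
  by_cases ht : IsSquare t
  · rw [if_pos ht, if_pos ht]
  -- Round `0` is a square; for `t ≠ 0` the gate looks only at times up to `2 ^ Nat.log 2 t ≤ t`,
  -- that is, at the past.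
  have ht0 : t ≠ 0 := by
    rintro rfl
    exact ht IsSquare.zero
  have hdev : ∀ i ≤ Nat.log 2 t,
      deviation x target m f (2 ^ i) = deviation x target m g (2 ^ i) := fun i hi =>
    deviation_congr x target m fun s hs => h s (hs.trans_le (Nat.pow_le_of_le_log ht0 hi))
  have hgate : Gate x target m f (Nat.log 2 t) ↔ Gate x target m g (Nat.log 2 t) := by
    unfold Gate
    refine exists_congr fun j => ?_
    rw [hdev _ le_rfl]
    exact and_congr_right fun _ => forall₂_congr fun i hi => by rw [hdev i hi.le]
  rw [if_neg ht, if_neg ht, exploreMean_congr h]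
  by_cases hf : Gate x target m f (Nat.log 2 t)
  · rw [if_pos hf, if_pos (hgate.1 hf)]
  · rw [if_neg hf, if_neg (mt hgate.2 hf)]

/-- The algorithm that plays according to `gatedChoice`. -/
def gatedAlgorithm : Algorithm k where
  pull := fun t _ h => gatedChoice x target m t (extendBy (target, 0) t h)
  measurable_pull := fun t => (measurable_gatedChoice x target m t).comp
    ((measurable_extendBy _ t).comp measurable_snd)

lemma arm_roundAt_gatedAlgorithm (θ : Vec d) (att : Attack k) (ω : Sample) (t : ℕ) :
    (roundAt x θ (gatedAlgorithm x target m) att ω t).arm = gatedChoice x target m t fun s =>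
      ((roundAt x θ (gatedAlgorithm x target m) att ω s).arm,
        (roundAt x θ (gatedAlgorithm x target m) att ω s).observed) := by
  rw [arm_roundAt]
  refine gatedChoice_congr x target m fun s hs => ?_
  rw [extendBy, dif_pos hs]

end Algorithm

/-! ### Perfect squares are sparse -/

lemma sum_isSquare_le (T : ℕ) :
    ∑ t ∈ Finset.range T, (if IsSquare t then (1 : ℝ) else 0) ≤ Nat.sqrt T + 1 := by
  rw [← Finset.sum_filter, Finset.sum_const, nsmul_eq_mul, mul_one]
  have hsub : {t ∈ Finset.range T | IsSquare t} ⊆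
      (Finset.range (Nat.sqrt T + 1)).image fun n => n * n := by
    intro t ht
    obtain ⟨htT, n, rfl⟩ := Finset.mem_filter.1 ht
    refine Finset.mem_image.2 ⟨n, Finset.mem_range.2 (Nat.lt_succ_of_le ?_), rfl⟩
    exact Nat.le_sqrt.2 (Finset.mem_range.1 htT).le
  have := (Finset.card_le_card hsub).trans Finset.card_image_le
  rw [Finset.card_range] at this
  exact_mod_cast this

lemma isLittleO_sum_isSquare :
    (fun T : ℕ => ∑ t ∈ Finset.range T, if IsSquare t then (1 : ℝ) else 0)
      =o[atTop] (fun T : ℕ => (T : ℝ)) := by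
  have h1 : (fun T : ℕ => √(T : ℝ)) =o[atTop] (fun T : ℕ => (T : ℝ)) := by
    refine isLittleO_of_tendsto (fun T hT => by rw [hT, Real.sqrt_zero]) ?_
    simp only [Real.sqrt_div_self']
    exact tendsto_const_nhds.div_atTop
      (Real.tendsto_sqrt_atTop.comp tendsto_natCast_atTop_atTop)
  have h2 : (fun _ : ℕ => (1 : ℝ)) =o[atTop] (fun T : ℕ => (T : ℝ)) :=
    (isLittleO_const_id_atTop (1 : ℝ)).comp_tendsto tendsto_natCast_atTop_atTop
  refine (IsBigO.of_bound 1 (Eventually.of_forall fun T => ?_)).trans_isLittleO (h1.add h2)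
  rw [one_mul, Real.norm_of_nonneg (Finset.sum_nonneg fun t _ => by split_ifs <;> simp),
    Real.norm_of_nonneg (by positivity)]
  exact (sum_isSquare_le T).trans (add_le_add_left Real.nat_sqrt_le_real_sqrt _)

/-! ### The gate -/

section Gate

variable {d k : ℕ} (x : Fin k → Vec d) (target : Fin k) (m : ℝ) (f : ℕ → Fin k × ℝ)

lemma sum_ne_target_nonneg (T : ℕ) :
    (0 : ℝ) ≤ ∑ t ∈ Finset.range T, if x (f t).1 = x target then (0 : ℝ) else 1 :=
  Finset.sum_nonneg fun t _ => by split_ifs <;> simp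

lemma deviation_pos (T : ℕ) : 0 < deviation x target m f T := by
  have := sum_ne_target_nonneg x target f T
  unfold deviation
  positivity

/-- The deviation is positive at every time, thanks to its term `1 / (T + 1)`, so some level lies
below all its values at `2 ^ i'` with `i' < N`. The first crossing of that level opens the gate at
an index at least `N`. -/
lemma frequently_gate_of_tendsto
    (h : Tendsto (fun T : ℕ => deviation x target m f T) atTop (𝓝 0)) :
    ∃ᶠ i in atTop, Gate x target m f i := by
  classical
  refine frequently_atTop.2 fun N => ?_
  have hj : ∀ᶠ j : ℕ in atTop, ∀ i' ∈ Finset.range N,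
      1 / ((j : ℝ) + 1) < deviation x target m f (2 ^ i') :=
    (eventually_all_finset _).2 fun i' _ =>
      tendsto_one_div_add_atTop_nhds_zero_nat.eventually_lt_const (deviation_pos x target m f _)
  obtain ⟨j, hj⟩ := hj.exists
  have hex : ∃ i : ℕ, deviation x target m f (2 ^ i) < 1 / ((j : ℝ) + 1) :=
    ((h.comp (tendsto_pow_atTop_atTop_of_one_lt one_lt_two)).eventually_lt_const
      (by positivity)).exists
  refine ⟨Nat.find hex, ?_, j, Nat.find_spec hex, fun i' hi' => not_lt.1 (Nat.find_min hex hi')⟩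
  by_contra! hlt
  exact lt_asymm (hj _ (Finset.mem_range.2 hlt)) (Nat.find_spec hex)

/-- A level witnesses the gate at only one index, that of its first crossing. Openings with
deviation at least `ε` use only the finitely many levels `j < J`, so by pigeonhole they are finite
in number. -/
lemma frequently_deviation_lt_of_frequently_gate (h : ∃ᶠ i in atTop, Gate x target m f i)
    {ε : ℝ} (hε : 0 < ε) : ∃ᶠ i in atTop, deviation x target m f (2 ^ i) < ε := by
  intro hev
  obtain ⟨J, hJ⟩ := exists_nat_one_div_lt hε
  have hinf : {i | Gate x target m f i ∧ ¬ deviation x target m f (2 ^ i) < ε}.Infinite :=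
    Nat.frequently_atTop_iff_infinite.1 (h.and_eventually hev)
  choose! j hj using fun i (hi : Gate x target m f i) => hi
  have hmaps : Set.MapsTo j {i | Gate x target m f i ∧ ¬ deviation x target m f (2 ^ i) < ε}
      (Set.Iio J) := by
    rintro i ⟨hi, hdev⟩
    by_contra hJi
    have h1 : (1 : ℝ) / ((j i : ℝ) + 1) ≤ 1 / ((J : ℝ) + 1) :=
      one_div_le_one_div_of_le (by positivity)
        (by exact_mod_cast Nat.succ_le_succ (not_lt.1 hJi))
    exact hdev ((hj i hi).1.trans_le (h1.trans hJ.le))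
  obtain ⟨i, hi, i', hi', hne, heq⟩ :=
    hinf.exists_ne_map_eq_of_mapsTo hmaps (Set.finite_Iio J)
  rcases lt_or_gt_of_ne hne with hlt | hlt
  · have h1 := (hj i' hi'.1).2 i hlt
    rw [← heq] at h1
    exact absurd (hj i hi.1).1 (not_lt.2 h1)
  · have h1 := (hj i hi.1).2 i' hlt
    rw [heq] at h1
    exact absurd (hj i' hi'.1).1 (not_lt.2 h1)

variable {x target m f}

/-- If the gate opens infinitely often, then the target is pulled in at most a fraction
`1 / 2 + o(1)` of the rounds along a subsequence. -/
lemma not_isLittleO_of_frequently_gate (hx : ∃ a, x a ≠ x target)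
    (hf : ∀ t, (f t).1 = gatedChoice x target m t f) (h : ∃ᶠ i in atTop, Gate x target m f i) :
    ¬ (fun T : ℕ => ∑ t ∈ Finset.range T, if x (f t).1 = x target then (0 : ℝ) else 1)
      =o[atTop] (fun T : ℕ => (T : ℝ)) := by
  intro hN
  -- At `T = 2 ^ (i + 1)` the bound `T / 4` is half the length `2 ^ i` of the last dyadic block,
  -- while every round of an open block is a square or misses the target.
  have hsum := (hN.add isLittleO_sum_isSquare).def (c := 1 / 4) (by norm_num)
  have hpow : Tendsto (fun i : ℕ => 2 ^ (i + 1)) atTop (atTop : Filter ℕ) :=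
    (tendsto_pow_atTop_atTop_of_one_lt one_lt_two).comp (tendsto_add_atTop_nat 1)
  obtain ⟨i, hgate, hi⟩ := (h.and_eventually (hpow.eventually hsum)).exists
  have hle : (2 : ℝ) ^ i ≤ ∑ t ∈ Finset.range (2 ^ (i + 1)),
      ((if x (f t).1 = x target then (0 : ℝ) else 1) + if IsSquare t then (1 : ℝ) else 0) := by
    have hsub : Finset.Ico (2 ^ i) (2 ^ (i + 1)) ⊆ Finset.range (2 ^ (i + 1)) := fun t ht =>
      Finset.mem_range.2 (Finset.mem_Ico.1 ht).2
    refine le_trans ?_ (Finset.sum_le_sum_of_subset_of_nonneg hsub fun t _ _ => by positivity)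
    have hcard : (2 : ℝ) ^ i = ∑ _t ∈ Finset.Ico (2 ^ i) (2 ^ (i + 1)), (1 : ℝ) := by
      rw [Finset.sum_const, Nat.card_Ico, nsmul_eq_mul, mul_one, pow_succ, mul_two,
        Nat.add_sub_cancel]
      push_cast
      rfl
    rw [hcard]
    refine Finset.sum_le_sum fun t ht => ?_
    by_cases hsq : IsSquare t
    · rw [if_pos hsq]
      have : (0 : ℝ) ≤ if x (f t).1 = x target then (0 : ℝ) else 1 := by positivity
      linarith
    · obtain ⟨h1, h2⟩ := Finset.mem_Ico.1 ht
      have hlog : Nat.log 2 t = i := Nat.log_eq_of_pow_le_of_lt_pow h1 h2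
      have hne : x (f t).1 ≠ x target := by
        rw [hf, gatedChoice, if_neg hsq, hlog, if_pos hgate]
        exact (argmaxOn_spec target (S := {a | x a ≠ x target}) hx _).1
      rw [if_neg hne, if_neg hsq, add_zero]
  rw [← Finset.sum_add_distrib] at hi
  have hup := (le_abs_self _).trans hi
  rw [Real.norm_of_nonneg (by positivity)] at hup
  push_cast at hup
  have hp : (0 : ℝ) < 2 ^ i := by positivity
  have h2 : (2 : ℝ) ^ (i + 1) = 2 ^ i * 2 := pow_succ 2 i
  linarith

end Gate

/-! ### The algorithm cannot be attacked -/

section Attacked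

variable {d k : ℕ} {x : Fin k → Vec d} {target : Fin k} {m : ℝ} {θ : Vec d}

lemma isLittleO_of_tendsto_div {u : ℕ → ℝ} (h : Tendsto (fun n : ℕ => u n / n) atTop (𝓝 0)) :
    u =o[atTop] (fun n : ℕ => (n : ℝ)) := by
  refine isLittleO_of_tendsto' ?_ h
  filter_upwards [eventually_ne_atTop 0] with n hn h0
  exact absurd (Nat.cast_eq_zero.1 h0) hn

/-- The rewards deviate from the mean of the target by at most the noise and a multiple of the
number of rounds in which the target is not pulled. -/
lemma exists_abs_sum_inner_sub_le (x : Fin k → Vec d) (target : Fin k) (θ : Vec d) :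
    ∃ C : ℝ, ∀ (A : ℕ → Fin k) (T : ℕ),
      |∑ t ∈ Finset.range T, ((inner ℝ (x (A t)) θ : ℝ) - inner ℝ (x target) θ)| ≤
        C * ∑ t ∈ Finset.range T, if x (A t) = x target then (0 : ℝ) else 1 := by
  obtain ⟨C, hC⟩ := (Set.finite_range fun a =>
    |(inner ℝ (x a) θ : ℝ) - inner ℝ (x target) θ|).bddAbove
  refine ⟨C, fun A T => (Finset.abs_sum_le_sum_abs _ _).trans ?_⟩
  rw [Finset.mul_sum]
  refine Finset.sum_le_sum fun t _ => ?_
  split_ifs with h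
  · rw [h]
    simp
  · rw [mul_one]
    exact hC ⟨_, rfl⟩

lemma tendsto_deviation {f : ℕ → Fin k × ℝ}
    (h1 : (fun T : ℕ => ∑ t ∈ Finset.range T, ((f t).2 - m)) =o[atTop] (fun T : ℕ => (T : ℝ)))
    (h2 : (fun T : ℕ => ∑ t ∈ Finset.range T, if x (f t).1 = x target then (0 : ℝ) else 1)
      =o[atTop] (fun T : ℕ => (T : ℝ))) :
    Tendsto (fun T : ℕ => deviation x target m f T) atTop (𝓝 0) := by
  have h := ((h1.norm_left.tendsto_div_nhds_zero).add h2.tendsto_div_nhds_zero).add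
    tendsto_one_div_add_atTop_nhds_zero_nat
  rw [add_zero, add_zero] at h
  exact h

/-- The sum of observed rewards minus `m` splits into corruption, the effect of non-target pulls,
and noise. Under a successful attack all three are `o(T)`, so the deviation tends to `0` and the
gate opens infinitely often, contradicting the pull count. -/
lemma notMem_attackSuccess_gatedAlgorithm (hx : ∃ a, x a ≠ x target) (att : Attack k)
    {ω : Sample}
    (hω : Tendsto (fun n : ℕ => (∑ i ∈ Finset.range n, ω.2.2 i) / (n : ℝ)) atTop (𝓝 0)) :
    ω ∉ attackSuccess x target θ (gatedAlgorithm x target (inner ℝ (x target) θ)) att := by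
  rintro ⟨hcost, hpull⟩
  set alg := gatedAlgorithm x target (inner ℝ (x target) θ)
  set f : ℕ → Fin k × ℝ := fun s =>
    ((roundAt x θ alg att ω s).arm, (roundAt x θ alg att ω s).observed) with hf
  simp only [sub_pullCount] at hpull
  refine not_isLittleO_of_frequently_gate (f := f) (m := inner ℝ (x target) θ) hx
    (fun t => arm_roundAt_gatedAlgorithm x target _ θ att ω t)
    (frequently_gate_of_tendsto x target _ f (tendsto_deviation ?_ hpull)) hpull
  obtain ⟨C, hC⟩ := exists_abs_sum_inner_sub_le x target θ
  have hmean : (fun T : ℕ => ∑ t ∈ Finset.range T,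
      ((inner ℝ (x (f t).1) θ : ℝ) - inner ℝ (x target) θ)) =o[atTop] (fun T : ℕ => (T : ℝ)) := by
    refine (IsBigO.of_bound C (Eventually.of_forall fun T => ?_)).trans_isLittleO hpull
    rw [Real.norm_of_nonneg (sum_ne_target_nonneg x target f T)]
    exact hC _ T
  have hcorr : (fun T : ℕ => ∑ t ∈ Finset.range T, ((roundAt x θ alg att ω t).observed -
      (roundAt x θ alg att ω t).reward)) =o[atTop] (fun T : ℕ => (T : ℝ)) := by
    refine (IsBigO.of_bound 1 (Eventually.of_forall fun T => ?_)).trans_isLittleO hcost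
    rw [one_mul]
    exact (Finset.abs_sum_le_sum_abs _ _).trans (le_abs_self _)
  refine ((hcorr.add hmean).add (isLittleO_of_tendsto_div hω)).congr_left fun T => ?_
  rw [← Finset.sum_add_distrib, ← Finset.sum_add_distrib]
  refine Finset.sum_congr rfl fun t _ => ?_
  rw [reward_roundAt]
  simp only [hf]
  ring

end Attacked

/-! ### The algorithm has no regret -/

section Regret

variable {d k : ℕ} {x : Fin k → Vec d} {target : Fin k} {m : ℝ} {θ : Vec d}
  {f : ℕ → Fin k × ℝ} {η : ℕ → ℝ}

lemma gatedChoice_exploration (a : Fin k) (i : ℕ) :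
    gatedChoice x target m ((k * i + a) ^ 2) f = a := by
  rw [gatedChoice, if_pos (IsSquare.sq _)]
  ext
  simp only [Nat.sqrt_eq', Nat.mul_add_mod, Nat.mod_eq_of_lt a.2]

/-- The exploration rounds of `a` are fixed in advance, so the noise is averaged along a
deterministic subsequence and the adaptivity of the algorithm plays no role. -/
lemma tendsto_exploreMean (hf : ∀ t, (f t).1 = gatedChoice x target m t f)
    (hobs : ∀ t, (f t).2 = inner ℝ (x (f t).1) θ + η t) (a : Fin k)
    (hη : Tendsto (fun n : ℕ => (∑ i ∈ Finset.range n, η ((k * i + a) ^ 2)) / (n : ℝ))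
      atTop (𝓝 0)) :
    Tendsto (fun t => exploreMean f t a) atTop (𝓝 (inner ℝ (x a) θ)) := by
  have h1 : Tendsto (fun n : ℕ => (∑ i ∈ Finset.range n, (f ((k * i + a) ^ 2)).2) / (n : ℝ))
      atTop (𝓝 (inner ℝ (x a) θ)) := by
    have h := hη.const_add (inner ℝ (x a) θ)
    rw [add_zero] at h
    refine h.congr' ?_
    filter_upwards [eventually_ne_atTop 0] with n hn
    have hn' : (n : ℝ) ≠ 0 := Nat.cast_ne_zero.2 hn
    simp only [hobs, hf, gatedChoice_exploration, Finset.sum_add_distrib, Finset.sum_const,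
      Finset.card_range, nsmul_eq_mul]
    field_simp
  have h2 : Tendsto (fun t => Nat.sqrt t / k) atTop atTop := by
    refine tendsto_atTop.2 fun N => ?_
    filter_upwards [eventually_ge_atTop ((N * k) ^ 2)] with t ht
    exact (Nat.le_div_iff_mul_le a.pos).2 (Nat.le_sqrt'.2 ht)
  exact h1.comp h2

lemma eventually_le_argmaxOn
    (hest : ∀ a, Tendsto (fun t => exploreMean f t a) atTop (𝓝 (inner ℝ (x a) θ)))
    {S : Set (Fin k)} (hS : S.Nonempty) :
    ∀ᶠ t in atTop, ∀ b ∈ S,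
      (inner ℝ (x b) θ : ℝ) ≤ inner ℝ (x (argmaxOn target S (exploreMean f t))) θ := by
  have hev : ∀ᶠ t in atTop, ∀ a b, (inner ℝ (x a) θ : ℝ) < inner ℝ (x b) θ →
      exploreMean f t a < exploreMean f t b := by
    refine eventually_all.2 fun a => eventually_all.2 fun b => ?_
    by_cases hab : (inner ℝ (x a) θ : ℝ) < inner ℝ (x b) θ
    · filter_upwards [(hest a).eventually_lt (hest b) hab] with t ht _ using ht
    · exact Eventually.of_forall fun _ h => absurd h hab
  filter_upwards [hev] with t ht b hb
  by_contra! hlt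
  exact absurd ((argmaxOn_spec target hS (exploreMean f t)).2 b hb) (not_le.2 (ht _ _ hlt))

/-- A small deviation means that the target is pulled almost always and that the average reward is
near `m`; without corruption that average is also near the target's true mean. -/
lemma inner_target_eq_of_frequently_gate
    (hobs : ∀ t, (f t).2 = inner ℝ (x (f t).1) θ + η t)
    (hη : Tendsto (fun n : ℕ => (∑ i ∈ Finset.range n, η i) / (n : ℝ)) atTop (𝓝 0))
    (h : ∃ᶠ i in atTop, Gate x target m f i) : (inner ℝ (x target) θ : ℝ) = m := by
  obtain ⟨C, hC⟩ := exists_abs_sum_inner_sub_le x target θ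
  by_contra hne
  have hpos : 0 < |(inner ℝ (x target) θ : ℝ) - m| := abs_pos.2 (sub_ne_zero.2 hne)
  set g := |(inner ℝ (x target) θ : ℝ) - m| with hg
  have hpow : Tendsto (fun i : ℕ => 2 ^ i) atTop (atTop : Filter ℕ) :=
    tendsto_pow_atTop_atTop_of_one_lt one_lt_two
  have hsmall := hpow.eventually
    ((isLittleO_of_tendsto_div hη).def (c := g / 2) (by positivity))
  -- The threshold is chosen so that `O + C * N ≤ (1 + |C|) * (O + N) < g / 2 * T`; the noise takes
  -- at most the other half of `g * T`.
  obtain ⟨i, hdev, hi⟩ := ((frequently_deviation_lt_of_frequently_gate x target m f h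
    (ε := g / (2 * (1 + |C|))) (by positivity)).and_eventually hsmall).exists
  set T : ℕ := 2 ^ i with hT
  have hT0 : (0 : ℝ) < T := by
    rw [hT]
    positivity
  set N : ℝ := ∑ t ∈ Finset.range T, if x (f t).1 = x target then (0 : ℝ) else 1 with hN
  have hN0 : 0 ≤ N := sum_ne_target_nonneg x target f T
  set O : ℝ := |∑ t ∈ Finset.range T, ((f t).2 - m)| with hO
  have hO0 : 0 ≤ O := abs_nonneg _
  have hsum : O + N < g / (2 * (1 + |C|)) * T := by
    have h0 : 0 < 1 / ((T : ℝ) + 1) := by positivity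
    have h1 : O / T + N / T + 1 / ((T : ℝ) + 1) < g / (2 * (1 + |C|)) := hdev
    rw [← div_lt_iff₀ hT0, add_div]
    linarith
  have hdecomp : (T : ℝ) * (inner ℝ (x target) θ - m) = ∑ t ∈ Finset.range T, ((f t).2 - m) -
      ∑ t ∈ Finset.range T, ((inner ℝ (x (f t).1) θ : ℝ) - inner ℝ (x target) θ) -
      ∑ t ∈ Finset.range T, η t := by
    rw [← Finset.sum_sub_distrib, ← Finset.sum_sub_distrib,
      Finset.sum_congr rfl (g := fun _ => (inner ℝ (x target) θ : ℝ) - m)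
        (fun t _ => by rw [hobs]; ring), Finset.sum_const, Finset.card_range, nsmul_eq_mul]
  have hbound : T * g ≤ O + C * N + g / 2 * T := by
    have h1 : (T : ℝ) * g = |(T : ℝ) * (inner ℝ (x target) θ - m)| := by
      rw [abs_mul, abs_of_pos hT0]
    rw [h1, hdecomp]
    refine (abs_sub _ _).trans (add_le_add ((abs_sub _ _).trans ?_) ?_)
    · exact add_le_add le_rfl (hC (fun t => (f t).1) T)
    · simpa [abs_of_pos hT0] using hi
  have hCN : O + C * N ≤ (1 + |C|) * (O + N) := by
    nlinarith [mul_le_mul_of_nonneg_right (le_abs_self C) hN0, mul_nonneg (abs_nonneg C) hO0]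
  have hC1 : 0 < 1 + |C| := by positivity
  have hfin : (1 + |C|) * (O + N) < g / 2 * T := by
    calc (1 + |C|) * (O + N) < (1 + |C|) * (g / (2 * (1 + |C|)) * T) :=
          mul_lt_mul_of_pos_left hsum hC1
      _ = g / 2 * T := by field_simp
  linarith

/-- If the target's mean is `m`, the best non-target arm is optimal by `hopt`, so an open gate does
no harm; otherwise the gate is eventually closed and the empirical leader is optimal. -/
lemma eventually_optimal (hf : ∀ t, (f t).1 = gatedChoice x target m t f)
    (hobs : ∀ t, (f t).2 = inner ℝ (x (f t).1) θ + η t)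
    (hη : Tendsto (fun n : ℕ => (∑ i ∈ Finset.range n, η i) / (n : ℝ)) atTop (𝓝 0))
    (hη' : ∀ a : Fin k, Tendsto
      (fun n : ℕ => (∑ i ∈ Finset.range n, η ((k * i + a) ^ 2)) / (n : ℝ)) atTop (𝓝 0))
    (hopt : (inner ℝ (x target) θ : ℝ) = m →
      ∃ a, x a ≠ x target ∧ (inner ℝ (x target) θ : ℝ) ≤ inner ℝ (x a) θ) :
    ∀ᶠ t in atTop, ¬ IsSquare t → ∀ b, (inner ℝ (x b) θ : ℝ) ≤ inner ℝ (x (f t).1) θ := by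
  have hest := fun a => tendsto_exploreMean hf hobs a (hη' a)
  have huniv := eventually_le_argmaxOn (target := target) hest (S := Set.univ) ⟨target, trivial⟩
  by_cases hm : (inner ℝ (x target) θ : ℝ) = m
  · obtain ⟨a, ha, hle⟩ := hopt hm
    filter_upwards [huniv,
      eventually_le_argmaxOn (target := target) hest (S := {a | x a ≠ x target}) ⟨a, ha⟩]
      with t h1 h2 hsq b
    rw [hf, gatedChoice, if_neg hsq]
    split_ifs
    · by_cases hb : x b = x target
      · rw [hb]
        exact hle.trans (h2 a ha)
      · exact h2 b hb
    · exact h1 b trivial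
  · have hgate : ∀ᶠ i in atTop, ¬ Gate x target m f i :=
      not_frequently.1 (mt (inner_target_eq_of_frequently_gate hobs hη) hm)
    have hlog : Tendsto (Nat.log 2) atTop atTop := tendsto_atTop.2 fun N => by
      filter_upwards [eventually_ge_atTop (2 ^ N)] with t ht
      exact Nat.le_log_of_pow_le one_lt_two ht
    filter_upwards [huniv, hlog.eventually hgate] with t h1 h2 hsq b
    rw [hf, gatedChoice, if_neg hsq, if_neg h2]
    exact h1 b trivial

/-- The sum is at most its first `t₀` terms plus `C` for each square, and squares have density zero.
-/
lemma isLittleO_sum_of_eventually_eq_zero {u : ℕ → ℝ} {C : ℝ} (h0 : ∀ t, 0 ≤ u t)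
    (hC : ∀ t, u t ≤ C) (hu : ∀ᶠ t in atTop, ¬ IsSquare t → u t = 0) :
    (fun T : ℕ => ∑ t ∈ Finset.range T, u t) =o[atTop] (fun T : ℕ => (T : ℝ)) := by
  obtain ⟨t₀, ht₀⟩ := eventually_atTop.1 hu
  have hC0 : 0 ≤ C := (h0 0).trans (hC 0)
  have hconst : (fun _ : ℕ => ∑ t ∈ Finset.range t₀, u t) =o[atTop] (fun T : ℕ => (T : ℝ)) :=
    (isLittleO_const_id_atTop _).comp_tendsto tendsto_natCast_atTop_atTop
  refine (IsBigO.of_bound 1 (Eventually.of_forall fun T => ?_)).trans_isLittleO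
    (hconst.add (isLittleO_sum_isSquare.const_mul_left C))
  have hsq0 : ∀ t : ℕ, (0 : ℝ) ≤ C * if IsSquare t then (1 : ℝ) else 0 := fun t => by positivity
  rw [one_mul, Real.norm_of_nonneg (Finset.sum_nonneg fun t _ => h0 t), Finset.mul_sum,
    Real.norm_of_nonneg (add_nonneg (Finset.sum_nonneg fun t _ => h0 t)
      (Finset.sum_nonneg fun t _ => hsq0 t))]
  induction T with
  | zero => simpa using Finset.sum_nonneg fun t _ => h0 t
  | succ T ih =>
    rcases lt_or_ge T t₀ with hT | hT
    · refine le_add_of_le_of_nonneg ?_ (Finset.sum_nonneg fun t _ => hsq0 t)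
      exact Finset.sum_le_sum_of_subset_of_nonneg (Finset.range_mono hT) fun t _ _ => h0 t
    · rw [Finset.sum_range_succ, Finset.sum_range_succ _ T]
      by_cases hsq : IsSquare T
      · rw [if_pos hsq]
        linarith [hC T]
      · rw [ht₀ T hT hsq, if_neg hsq]
        linarith

lemma regret_gatedAlgorithm_isLittleO {ω : Sample}
    (hη : Tendsto (fun n : ℕ => (∑ i ∈ Finset.range n, ω.2.2 i) / (n : ℝ)) atTop (𝓝 0))
    (hη' : ∀ a : Fin k, Tendsto
      (fun n : ℕ => (∑ i ∈ Finset.range n, ω.2.2 ((k * i + a) ^ 2)) / (n : ℝ)) atTop (𝓝 0))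
    (hopt : (inner ℝ (x target) θ : ℝ) = m →
      ∃ a, x a ≠ x target ∧ (inner ℝ (x target) θ : ℝ) ≤ inner ℝ (x a) θ) :
    (fun T : ℕ => regret x θ (gatedAlgorithm x target m) ω T) =o[atTop] (fun T : ℕ => (T : ℝ)) := by
  have hsup : ∀ a, (inner ℝ (x a) θ : ℝ) ≤ ⨆ a, inner ℝ (x a) θ :=
    fun a => le_ciSup (f := fun a => (inner ℝ (x a) θ : ℝ)) (Set.finite_range _).bddAbove a
  obtain ⟨C, hC⟩ := (Set.finite_range fun a =>
    (⨆ a, inner ℝ (x a) θ : ℝ) - inner ℝ (x a) θ).bddAbove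
  have : Nonempty (Fin k) := ⟨target⟩
  refine isLittleO_sum_of_eventually_eq_zero (C := C) (fun t => sub_nonneg.2 (hsup _))
    (fun t => hC ⟨_, rfl⟩) ?_
  filter_upwards [eventually_optimal
    (f := fun s => ((roundAt x θ (gatedAlgorithm x target m) (Attack.none k) ω s).arm,
      (roundAt x θ (gatedAlgorithm x target m) (Attack.none k) ω s).observed))
    (arm_roundAt_gatedAlgorithm x target m θ (Attack.none k) ω)
    (observed_roundAt_none x θ _ ω) hη hη' hopt] with t ht hsq
  exact sub_eq_zero.2 (le_antisymm (ciSup_le (ht hsq)) (hsup _))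

end Regret

/-! ### Non-attackability when the index is not positive -/

section Negative

variable {d k : ℕ} {x : Fin k → Vec d} {target : Fin k} {θ : Vec d}

lemma ae_sampleMeasure {μ : Measure (ℕ → ℝ)} [SFinite μ] {p : (ℕ → ℝ) → Prop}
    (h : ∀ᵐ η ∂μ, p η) : ∀ᵐ ω ∂sampleMeasure μ, p ω.2.2 :=
  (Measure.quasiMeasurePreserving_snd.comp Measure.quasiMeasurePreserving_snd).ae h

lemma noRegret_gatedAlgorithm (R : ℝ≥0) (h : attackabilityIndex x target θ ≤ 0) {δ : ℝ}
    (hδ : 0 ≤ δ) : NoRegret R x δ (gatedAlgorithm x target (inner ℝ (x target) θ)) := by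
  intro θ' hθ' μ hμ
  have := hμ.isProbabilityMeasure
  have : IsProbabilityMeasure (sampleMeasure μ) := by
    unfold sampleMeasure
    infer_instance
  have h1 := ae_sampleMeasure (hμ.ae_tendsto_average Function.injective_id)
  have h2 : ∀ᵐ ω ∂sampleMeasure μ, ∀ a : Fin k, Tendsto
      (fun n : ℕ => (∑ i ∈ Finset.range n, ω.2.2 ((k * i + a) ^ 2)) / (n : ℝ)) atTop (𝓝 0) := by
    refine ae_all_iff.2 fun a => ae_sampleMeasure (hμ.ae_tendsto_average
      (s := fun i => (k * i + a) ^ 2) fun i j hij => ?_)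
    have := Nat.pow_left_injective two_ne_zero hij
    exact Nat.eq_of_mul_eq_mul_left a.pos (Nat.add_right_cancel this)
  have hae : ∀ᵐ ω ∂sampleMeasure μ, ω ∈ {ω | (fun T : ℕ => regret x θ'
      (gatedAlgorithm x target (inner ℝ (x target) θ)) ω T) =o[atTop] (fun T : ℕ => (T : ℝ))} := by
    filter_upwards [h1, h2] with ω h1 h2
    exact regret_gatedAlgorithm_isLittleO h1 h2 (exists_ne_target_inner_le x target θ h hθ')
  exact (ENNReal.ofReal_le_one.2 (sub_le_self 1 hδ)).trans_eq
    ((measure_congr (eventuallyEq_univ.2 hae)).trans measure_univ).symm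

theorem not_attackable_of_attackabilityIndex_nonpos (hθ : ‖θ‖ ≤ 1) (R : ℝ≥0)
    (μ : Measure (ℕ → ℝ)) (hμ : IsSubGaussianNoise R μ)
    (h : attackabilityIndex x target θ ≤ 0) : ¬ Attackable R x target θ μ := by
  intro hatt
  have := hμ.isProbabilityMeasure
  obtain ⟨att, hsucc⟩ := hatt (1 / 2) (by norm_num) (by norm_num) _
    (noRegret_gatedAlgorithm R h (by norm_num))
  -- Applied to `θ` itself, this supplies a context vector different from the target's, so that an
  -- open gate has an arm to play.
  obtain ⟨a, ha, -⟩ := exists_ne_target_inner_le x target θ h hθ rfl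
  have hnull : sampleMeasure μ (attackSuccess x target θ
      (gatedAlgorithm x target (inner ℝ (x target) θ)) att) = 0 := by
    refine measure_eq_zero_iff_ae_notMem.2 ?_
    filter_upwards [ae_sampleMeasure (hμ.ae_tendsto_average Function.injective_id)] with ω hω
    exact notMem_attackSuccess_gatedAlgorithm ⟨a, ha⟩ att hω
  rw [hnull, nonpos_iff_eq_zero, ENNReal.ofReal_eq_zero] at hsucc
  norm_num at hsucc

end Negative

end LinBandit

end

theorem mainTheorem1 {d k : ℕ} (x : Fin k → LinBandit.Vec d) (target : Fin k)
    (θ : LinBandit.Vec d) (hθ : ‖θ‖ ≤ 1) (R : ℝ≥0) (μ : Measure (ℕ → ℝ))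
    (hμ : LinBandit.IsSubGaussianNoise R μ) :
    LinBandit.Attackable R x target θ μ ↔ 0 < LinBandit.attackabilityIndex x target θ :=
  ⟨fun h => not_le.1 fun hle =>
    LinBandit.not_attackable_of_attackabilityIndex_nonpos hθ R μ hμ hle h,
    LinBandit.attackable_of_attackabilityIndex_pos x target θ R μ hμ⟩
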